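/- Let $\mathcal X_o\subset\mathbb R^d$ be compact and let $(x_i,t_i)_{i=1}^N$, with $x_i\in\mathcal X_o$ and $t_i\in\{0,1\}$, be an experimental design with known propensity score $\pi$ satisfying $0<\pi(x_i)<1$. All probabilities are conditional on this (arbitrary, fixed) design. Let $\mu_t(x)$, $t\in\{0,1\}$, be the unknown mean potential outcomes, $\tau=\mu_1-\mu_0$ the conditional average treatment effect, $\hat\omega$ a given (fixed) estimate of the treatment effect from observational data, $\hat\Delta=\tau-\hat\omega$ and $\phi=(1-\pi)\mu_1+\pi\mu_0$. From the experimental outcomes $Y_i$ form the pseudo-outcomes $\tilde Y_i=w_iY_i$ with $w_i=\frac{t_i-\pi(x_i)}{\pi(x_i)(1-\pi(x_i))}$, and put $y_N=(\tilde Y_i-\hat\omega(x_i))_{i=1}^N$. Assume that $\hat\Delta\sim\mathrm{GP}(0,k)$ and $\phi\sim\mathrm{GP}(0,l)$ are independent Gaussian processes on $\mathcal X_o$; that the errors $\tilde\epsilon_i=\tilde Y_i-\tau(x_i)-w_i\phi(x_i)$ are independent of each other and of $(\hat\Delta,\phi)$, with $\tilde\epsilon_i\sim\mathcal N(0,\sigma_{t_i}^2)$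 and $\sigma_0,\sigma_1>0$; that $k$ is Lipschitz in each argument on $\mathcal X_o$ with constant $L_k$; and that almost surely $\hat\Delta$ is Lipschitz on $\mathcal X_o$ with a constant $L_{\hat\Delta}$, which may depend on the sample path. Let $b_0(x)=-\frac1{1-\pi(x)}$, $b_1(x)=\frac1{\pi(x)}$, $(M_N)_{ij}=k(x_i,x_j)+b_{t_i}(x_i)\,b_{t_j}(x_j)\,l(x_i,x_j)$, $\Sigma_N=\mathrm{diag}(\sigma_{t_i}^2)$, $k_N(x)=(k(x_i,x))_i$, and $$\tilde\Delta(x)=k_N(x)^\top(M_N+\Sigma_N)^{-1}y_N,\qquad \sigma^2(x)=k(x,x)-k_N(x)^\top(M_N+\Sigma_N)^{-1}k_N(x).$$ Then for every $x\in\mathcal X_o$ the posterior law of $\hat\Delta(x)$ given $y_N$ is $\mathcal N(\tilde\Delta(x),\sigma^2(x))$. Moreover, with $\hat\tau=\hat\omega+\tilde\Delta$, for all fixed $\delta\in(0,1)$ and $r>0$, $$P\bigl(|\hat\tau(x)-\tau(x)|\le B(x)\ \ \forall x\in\mathcal X_o\bigr)>1-\delta,\qquad B(x)=\sqrt{2\log\bigl(M(r,\mathcal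 X_o)/\delta\bigr)}\;\sigma(x)+\gamma,$$ where $M(r,\mathcal X_o)$ is the minimum number of closed balls of radius $r$ centred in $\mathcal X_o$ needed to cover $\mathcal X_o$ and $$\gamma=\Bigl(L_k\sqrt N\,\bigl\|(M_N+\Sigma_N)^{-1}y_N\bigr\|+L_{\hat\Delta}\Bigr)r+\sqrt{2\log\bigl(M(r,\mathcal X_o)/\delta\bigr)}\,\sqrt{2rL_k\Bigl(1+N\bigl\|(M_N+\Sigma_N)^{-1}\bigr\|\max_{x,x'\in\mathcal X_o}k(x,x')\Bigr)},$$ with the Euclidean norm for vectors and the spectral norm for matrices. (If the event is not measurable, the claim is that it contains a measurable event of probability greater than $1-\delta$.) -/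

import Mathlib

open MeasureTheory ProbabilityTheory
open scoped NNReal ENNReal Matrix

noncomputable section

namespace PseudoGP

/-- Covariates live in `ℝ^d` with the Euclidean norm. -/
abbrev Cov (d : ℕ) := EuclideanSpace ℝ (Fin d)

/-! ### Causal quantities

`m t x ω` is the mean potential outcome `E[Y(t) | X = x]`, an unknown (random) function of `x`.
The treatment `t` takes the values `0, 1 : Fin 2`. -/

section Causal

variable {d : ℕ} {Ω : Type*}

/-- The conditional average treatment effect `τ(x) = E[Y(1) - Y(0) | X = x]`. -/
def cate (m : Fin 2 → Cov d → Ω → ℝ) (x : Cov d) (ω : Ω) : ℝ :=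
  m 1 x ω - m 0 x ω

/-- The correction function `Δ̂ = τ - ω̂` of an observational estimate `ωhat`. -/
def correction (m : Fin 2 → Cov d → Ω → ℝ) (ωhat : Cov d → ℝ) (x : Cov d) (ω : Ω) : ℝ :=
  cate m x ω - ωhat x

/-- The nuisance function `φ = (1 - π) m₁ + π m₀` of the pseudo-outcome decomposition. -/
def nuisance (m : Fin 2 → Cov d → Ω → ℝ) (π : Cov d → ℝ) (x : Cov d) (ω : Ω) : ℝ :=
  (1 - π x) * m 1 x ω + π x * m 0 x ω

/-- The inverse propensity weight `(t - π(x)) / (π(x) (1 - π(x)))`. -/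
def ipwWeight (π : Cov d → ℝ) (t : Fin 2) (x : Cov d) : ℝ :=
  (((t : ℕ) : ℝ) - π x) / (π x * (1 - π x))

/-- The IPW pseudo-outcome `Ỹ` of a unit with covariate `x`, treatment `t`, outcome `y`. -/
def pseudoOutcome (π : Cov d → ℝ) (t : Fin 2) (x : Cov d) (y : ℝ) : ℝ :=
  ipwWeight π t x * y

/-- The error `ε̃ᵢ` in `Ỹᵢ = τ(xᵢ) + (tᵢ - π(xᵢ)) / (π(xᵢ) (1 - π(xᵢ))) φ(xᵢ) + ε̃ᵢ`. -/
def pseudoError {n : ℕ} (m : Fin 2 → Cov d → Ω → ℝ) (π : Cov d → ℝ)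
    (x : Fin n → Cov d) (t : Fin n → Fin 2) (Y : Fin n → Ω → ℝ) (i : Fin n) (ω : Ω) : ℝ :=
  pseudoOutcome π (t i) (x i) (Y i ω)
    - (cate m (x i) ω + ipwWeight π (t i) (x i) * nuisance m π (x i) ω)

/-- The vector of regression targets `yᵢ = Ỹᵢ - ω̂(xᵢ)`. -/
def target {n : ℕ} (ωhat : Cov d → ℝ) (π : Cov d → ℝ)
    (x : Fin n → Cov d) (t : Fin n → Fin 2) (Y : Fin n → Ω → ℝ) (ω : Ω) : Fin n → ℝ :=
  fun i => pseudoOutcome π (t i) (x i) (Y i ω) - ωhat (x i)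

end Causal

/-- `f` is, on the index set `S`, a Gaussian process with mean zero and covariance kernel `K`. -/
structure IsCenteredGP {d : ℕ} {Ω : Type*} [MeasurableSpace Ω] (S : Set (Cov d))
    (K : Cov d → Cov d → ℝ) (f : Cov d → Ω → ℝ) (P : Measure Ω) : Prop where
  gaussian : IsGaussianProcess (fun x : S => f x) P
  mean_zero : ∀ x ∈ S, ∫ ω, f x ω ∂P = 0
  covariance_eq : ∀ x ∈ S, ∀ x' ∈ S, cov[f x, f x'; P] = K x x'

/-! ### The posterior of the pseudo-outcome Gaussian process -/

section Posterior

variable {d : ℕ}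

/-- Loadings of the three tasks (control arm, treated arm, treatment effect) on `Δ̂`. -/
def loadA : Fin 3 → ℝ := ![1, 1, 1]

/-- Loadings of the three tasks on `φ`. -/
def loadB (π : Cov d → ℝ) (x : Cov d) : Fin 3 → ℝ := ![-1 / (1 - π x), 1 / π x, 0]

/-- The multitask kernel `a aᵀ k + b bᵀ l`. -/
def multitaskKernel (π : Cov d → ℝ) (k l : Cov d → Cov d → ℝ) (x x' : Cov d) :
    Matrix (Fin 3) (Fin 3) ℝ :=
  k x x' • Matrix.vecMulVec loadA loadA + l x x' • Matrix.vecMulVec (loadB π x) (loadB π x')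

variable {n : ℕ} (k l : Cov d → Cov d → ℝ) (π : Cov d → ℝ) (s : Fin 2 → ℝ≥0)
  (x : Fin n → Cov d) (t : Fin n → Fin 2)

/-- The Gram matrix `M_N` with entries `K(xᵢ, xⱼ)_{tᵢ, tⱼ}`. -/
def gram : Matrix (Fin n) (Fin n) ℝ :=
  Matrix.of fun i j => multitaskKernel π k l (x i) (x j) (t i).castSucc (t j).castSucc

/-- The noise covariance `Σ_N = diag(σ²_{tᵢ})`. -/
def noiseCov : Matrix (Fin n) (Fin n) ℝ :=
  Matrix.diagonal fun i => (s (t i) : ℝ) ^ 2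

/-- The precision matrix `(M_N + Σ_N)⁻¹`. -/
def precision : Matrix (Fin n) (Fin n) ℝ :=
  (gram k l π x t + noiseCov s t)⁻¹

/-- The vector `k_N(z) = (k(xᵢ, z))ᵢ`. -/
def crossCov (z : Cov d) : Fin n → ℝ := fun i => k (x i) z

/-- The posterior mean `Δ̃(z)` given the target vector `y`. -/
def postMean (z : Cov d) (y : Fin n → ℝ) : ℝ :=
  crossCov k x z ⬝ᵥ (precision k l π s x t *ᵥ y)

/-- The posterior covariance. -/
def postCov (z z' : Cov d) : ℝ :=
  k z z' - crossCov k x z ⬝ᵥ (precision k l π s x t *ᵥ crossCov k x z')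

/-- The posterior standard deviation `σ(z)`. -/
def postStd (z : Cov d) : ℝ := √(postCov k l π s x t z z)

/-- The estimate `τ̂(z) = ω̂(z) + Δ̃(z)`. -/
def cateEstimate (ωhat : Cov d → ℝ) (z : Cov d) (y : Fin n → ℝ) : ℝ :=
  ωhat z + postMean k l π s x t z y

/-! ### The uniform error bound -/

/-- `β(r) = 2 log (M(r, S) / δ)`, where `M(r, S)` is the least number of balls of radius `r`
centred in `S` that cover `S`. -/
def beta (S : Set (Cov d)) (r : ℝ≥0) (δ : ℝ) : ℝ :=
  2 * Real.log (((Metric.coveringNumber r S).toNat : ℝ) / δ)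

/-- The Lipschitz bound `L_k √N ‖(M_N + Σ_N)⁻¹ y‖` of the posterior mean. -/
def lipMean (Lk : ℝ≥0) (y : Fin n → ℝ) : ℝ :=
  Lk * √(n : ℝ) * ‖WithLp.toLp 2 (precision k l π s x t *ᵥ y)‖

/-- The bound `√(2 r L_k (1 + N ‖(M_N + Σ_N)⁻¹‖ max k))` of the modulus of continuity of the
posterior standard deviation; the matrix norm is the spectral norm. -/
def modStd (S : Set (Cov d)) (Lk r : ℝ≥0) : ℝ :=
  √(2 * r * Lk *
    (1 + n * ‖Matrix.toEuclideanCLM (𝕜 := ℝ) (precision k l π s x t)‖ * sSup (Set.image2 k S S)))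

/-- The term `γ`, for the Lipschitz constant `L` of the correction function. -/
def gammaTerm (S : Set (Cov d)) (Lk L r : ℝ≥0) (δ : ℝ) (y : Fin n → ℝ) : ℝ :=
  (lipMean k l π s x t Lk y + L) * r + √(beta S r δ) * modStd k l π s x t S Lk r

/-- The half-width `B(z) = √(2 log (M(r, S) / δ)) σ(z) + γ`. -/
def band (S : Set (Cov d)) (Lk L r : ℝ≥0) (δ : ℝ) (y : Fin n → ℝ) (z : Cov d) : ℝ :=
  √(beta S r δ) * postStd k l π s x t z + gammaTerm k l π s x t S Lk L r δ y

end Posterior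

end PseudoGP

end

/-! Write w for the inverse propensity weights. The targets are yᵢ = Δ̂(xᵢ) + wᵢ φ(xᵢ) + ε̃ᵢ, a
linear image of three independent Gaussian blocks. Hence (Δ̂(z), y) is jointly Gaussian and centred,
with Cov(y) = M_N + Σ_N and Cov(Δ̂(z), y) = k_N(z) (`joint_law`). The posterior mean is the linear
regression of Δ̂(z) on y. Its residual is uncorrelated with y, so independent of y by joint
Gaussianity, and has variance σ²(z) (`regression_residual`, `prediction_error`). Adding back a
function of y gives the conditional law (`condDistrib_add_gaussian`).

For the uniform bound, take a minimal r-net C of the compact space. At each centre c the residual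
exceeds √β σ(c) with probability strictly below exp(-β/2) = δ/|C| (`gaussianReal_real_lt_abs_lt`),
so the union bound costs less than δ. Passing from a centre to a point within r changes Δ̂, Δ̃ and σ
by amounts controlled on each path (`abs_postMean_sub_le`, `postStd_le_add_modStd`); these three
changes make up γ. They are deterministic inequalities, so γ may depend on y and on the path. -/

namespace PseudoGP

/-! ### Strict Gaussian tail bounds -/

theorem gaussianReal_real_Ioi_zero_le :
    (gaussianReal 0 1).real (Set.Ioi 0) ≤ 1 / 2 := by
  have hneg : (gaussianReal 0 1).real (Set.Iio 0) = (gaussianReal 0 1).real (Set.Ioi 0) := by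
    conv_lhs => rw [← neg_zero (G := ℝ), ← gaussianReal_map_neg]
    rw [map_measureReal_apply measurable_neg measurableSet_Iio]
    congr 1
    ext u
    simp
  have hunion : (gaussianReal 0 1).real (Set.Iio 0 ∪ Set.Ioi 0) ≤ 1 := measureReal_le_one
  have hdisj : Disjoint (Set.Iio (0 : ℝ)) (Set.Ioi 0) :=
    Set.disjoint_left.2 fun u hu hu' => lt_asymm (Set.mem_Iio.1 hu) (Set.mem_Ioi.1 hu')
  rw [measureReal_union hdisj measurableSet_Ioi] at hunion
  linarith

/-- Shifting by c multiplies the standard density at u by exp(-c²/2) exp(-cu). The last factor is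
below 1 for u > 0, so the tail is strictly less than exp(-c²/2) times the mass of the positive
half-line. The factor 1/2 absorbs the two sides later. -/
theorem gaussianReal_real_Ioi_lt {c : ℝ} (hc : 0 < c) :
    (gaussianReal 0 1).real (Set.Ioi c) < Real.exp (-c ^ 2 / 2) / 2 := by
  have hreal_Ioi (a : ℝ) : (gaussianReal 0 1).real (Set.Ioi a)
      = ∫ u in Set.Ioi a, gaussianPDFReal 0 1 u := by
    rw [measureReal_def, gaussianReal_apply_eq_integral _ one_ne_zero, ENNReal.toReal_ofReal]
    exact integral_nonneg fun u => gaussianPDFReal_nonneg _ _ _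
  have hpdf : Integrable (gaussianPDFReal 0 1) := integrable_gaussianPDFReal 0 1
  have hshift : ∫ u in Set.Ioi c, gaussianPDFReal 0 1 u
      = ∫ u in Set.Ioi 0, gaussianPDFReal 0 1 (u + c) := by
    rw [← (measurePreserving_add_right volume c).setIntegral_preimage_emb
      (measurableEmbedding_addRight c) (gaussianPDFReal 0 1) (Set.Ioi c)]
    simp
  have hprod (u : ℝ) : gaussianPDFReal 0 1 (u + c)
      = Real.exp (-c ^ 2 / 2) * (Real.exp (-(c * u)) * gaussianPDFReal 0 1 u) := by
    simp only [gaussianPDFReal, sub_zero, NNReal.coe_one, mul_one]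
    rw [mul_left_comm (Real.exp (-(c * u))), mul_left_comm (Real.exp (-c ^ 2 / 2)),
      ← Real.exp_add, ← Real.exp_add]
    ring_nf
  have hshift_int : IntegrableOn (fun u => gaussianPDFReal 0 1 (u + c)) (Set.Ioi 0) :=
    (hpdf.comp_add_right c).integrableOn
  have hpos : 0 < ∫ u in Set.Ioi 0,
      (Real.exp (-c ^ 2 / 2) * gaussianPDFReal 0 1 u - gaussianPDFReal 0 1 (u + c)) := by
    have hlt (u : ℝ) (hu : u ∈ Set.Ioi 0) :
        0 < Real.exp (-c ^ 2 / 2) * gaussianPDFReal 0 1 u - gaussianPDFReal 0 1 (u + c) := by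
      rw [hprod, ← mul_sub]
      have h1 : Real.exp (-(c * u)) < 1 :=
        by simpa using mul_pos hc hu
      have h2 := gaussianPDFReal_pos 0 1 u one_ne_zero
      have h3 := Real.exp_pos (-c ^ 2 / 2)
      exact mul_pos h3 (by nlinarith)
    rw [setIntegral_pos_iff_support_of_nonneg_ae]
    · have hsub : Set.Ioi 0 ⊆ Function.support fun u =>
          Real.exp (-c ^ 2 / 2) * gaussianPDFReal 0 1 u - gaussianPDFReal 0 1 (u + c) :=
        fun u hu => Function.mem_support.2 (hlt u hu).ne'
      rw [Set.inter_eq_self_of_subset_right hsub]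
      simp
    · filter_upwards [ae_restrict_mem measurableSet_Ioi] with u hu using (hlt u hu).le
    · exact (hpdf.integrableOn.const_mul _).sub hshift_int
  rw [integral_sub (hpdf.integrableOn.const_mul _) hshift_int, integral_const_mul, ← hshift,
    ← hreal_Ioi, ← hreal_Ioi] at hpos
  have h3 := Real.exp_pos (-c ^ 2 / 2)
  nlinarith [gaussianReal_real_Ioi_zero_le]

/-- The two-sided Gaussian tail bound, with strict inequality. -/
theorem gaussianReal_real_lt_abs_lt (v : ℝ≥0) {c : ℝ} (hc : 0 < c) :
    (gaussianReal 0 v).real {u | c * √v < |u|} < Real.exp (-c ^ 2 / 2) := by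
  -- The posterior variance may vanish; the law is then a Dirac mass at 0 and the event is null.
  rcases eq_or_ne v 0 with rfl | hv
  · simp [gaussianReal_zero_var, measureReal_def, Real.exp_pos]
  have hv' : 0 < √(v : ℝ) := Real.sqrt_pos.2 (NNReal.coe_pos.2 (pos_iff_ne_zero.2 hv))
  have hmap : gaussianReal 0 v = (gaussianReal 0 1).map (√(v : ℝ) * ·) := by
    rw [gaussianReal_map_const_mul, mul_zero, mul_one]
    congr 1
    ext
    simp
  have hset : (√(v : ℝ) * ·) ⁻¹' {u | c * √v < |u|} = Set.Ioi c ∪ Set.Iio (-c) := by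
    ext u
    simp only [Set.mem_preimage, Set.mem_ofPred_eq, Set.mem_union, Set.mem_Ioi, Set.mem_Iio,
      abs_mul, abs_of_pos hv']
    rw [mul_comm c, mul_lt_mul_iff_right₀ hv', lt_abs, lt_neg]
  have hneg : (gaussianReal 0 1).real (Set.Iio (-c)) = (gaussianReal 0 1).real (Set.Ioi c) := by
    conv_lhs => rw [← neg_zero (G := ℝ), ← gaussianReal_map_neg]
    rw [map_measureReal_apply measurable_neg measurableSet_Iio]
    congr 1
    ext u
    simp
  rw [hmap, map_measureReal_apply (by fun_prop)
    (measurableSet_lt measurable_const continuous_abs.measurable), hset]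
  refine (measureReal_union_le _ _).trans_lt ?_
  rw [hneg]
  linarith [gaussianReal_real_Ioi_lt hc]

/-! ### Conditioning by Gaussian regression -/

/-- Conditionally on `X`, the sum of a function of `X` and an independent centered Gaussian
variable is Gaussian. -/
theorem condDistrib_add_gaussian {Ω β : Type*} [MeasurableSpace Ω] [MeasurableSpace β]
    {P : Measure Ω} [IsProbabilityMeasure P] {X : Ω → β} {U R : Ω → ℝ} {g : β → ℝ} {v : ℝ≥0}
    (hX : AEMeasurable X P) (hg : Measurable g) (hR : HasLaw R (gaussianReal 0 v) P)
    (hXR : IndepFun X R P) (hU : ∀ ω, U ω = g (X ω) + R ω) :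
    condDistrib U X P =ᵐ[P.map X] fun b => gaussianReal (g b) v := by
  have hsum : Measurable fun p : β × ℝ => g p.1 + p.2 := by fun_prop
  set κ : Kernel β ℝ :=
    (Kernel.id ×ₖ Kernel.const β (gaussianReal 0 v)).map fun p => g p.1 + p.2 with hκ
  have : IsMarkovKernel κ := Kernel.IsMarkovKernel.map _ hsum
  have hκ_apply (b : β) : κ b = gaussianReal (g b) v := by
    rw [hκ, Kernel.map_apply _ hsum, Kernel.prod_apply, Kernel.id_apply, Kernel.const_apply,
      Measure.dirac_prod, Measure.map_map hsum (by fun_prop)]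
    have : ((fun p : β × ℝ => g p.1 + p.2) ∘ Prod.mk b) = (g b + ·) := rfl
    rw [this, gaussianReal_map_const_add, zero_add]
  have hU' : U = fun ω => g (X ω) + R ω := funext hU
  have hmeas : AEMeasurable U P := by
    rw [hU']
    exact (hg.comp_aemeasurable hX).add hR.aemeasurable
  have hmain : P.map (fun ω => (X ω, U ω)) = P.map X ⊗ₘ κ := by
    have hpair : Measurable fun p : β × ℝ => (p.1, g p.1 + p.2) := by fun_prop
    have hlaw : P.map (fun ω => (X ω, R ω)) = (P.map X).prod (gaussianReal 0 v) := by
      rw [← hR.map_eq]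
      exact (indepFun_iff_map_prod_eq_prod_map_map hX hR.aemeasurable).1 hXR
    have hleft : P.map (fun ω => (X ω, U ω))
        = ((P.map X).prod (gaussianReal 0 v)).map fun p => (p.1, g p.1 + p.2) := by
      rw [← hlaw, AEMeasurable.map_map_of_aemeasurable hpair.aemeasurable
        (hX.prodMk hR.aemeasurable), hU']
      rfl
    have := Measure.isProbabilityMeasure_map hX
    rw [hleft]
    ext A hA
    rw [Measure.map_apply hpair hA, Measure.prod_apply (hpair hA), Measure.compProd_apply hA]
    refine lintegral_congr fun b => ?_
    rw [hκ_apply, ← zero_add (g b), ← gaussianReal_map_add_const, Measure.map_apply (by fun_prop)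
      (measurable_prodMk_left hA)]
    congr 1
    ext u
    simp [add_comm]
  filter_upwards [condDistrib_ae_eq_of_measure_eq_compProd X hmeas hmain] with b hb
  rw [hb, hκ_apply]

/-- The residual of a linear regression with normal equations `hc` is a centered Gaussian variable
independent of the regressors. -/
theorem regression_residual {Ω ι : Type*} [MeasurableSpace Ω] [Fintype ι] {P : Measure Ω}
    [IsProbabilityMeasure P] {U : Ω → ℝ} {y : ι → Ω → ℝ}
    (h : HasGaussianLaw (fun ω => (U ω, fun i => y i ω)) P) (hU0 : P[U] = 0)
    (hy0 : ∀ i, P[y i] = 0) (c : ι → ℝ)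
    (hc : ∀ j, ∑ i, c i * cov[y i, y j; P] = cov[U, y j; P]) :
    IndepFun (fun ω i => y i ω) (fun ω => U ω - ∑ i, c i * y i ω) P ∧
      0 ≤ cov[U, U; P] - ∑ i, c i * cov[U, y i; P] ∧
      HasLaw (fun ω => U ω - ∑ i, c i * y i ω)
        (gaussianReal 0 (cov[U, U; P] - ∑ i, c i * cov[U, y i; P]).toNNReal) P := by
  have hU2 : MemLp U 2 P := h.fst.memLp_two
  have hy (i : ι) : HasGaussianLaw (y i) P := h.snd.eval i
  have hy2 (i : ι) : MemLp (y i) 2 P := (hy i).memLp_two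
  have hcy2 (i : ι) : MemLp (fun ω => c i * y i ω) 2 P := (hy2 i).const_mul _
  have hS2 : MemLp (fun ω => ∑ i, c i * y i ω) 2 P := memLp_finsetSum _ fun i _ => hcy2 i
  set R : Ω → ℝ := fun ω => U ω - ∑ i, c i * y i ω with hR
  -- The residual is viewed as a family over `Unit` to fit the criterion that jointly Gaussian,
  -- uncorrelated families are independent.
  let T : ℝ × (ι → ℝ) →L[ℝ] (Unit → ℝ) × (ι → ℝ) :=
    ContinuousLinearMap.prod
      (ContinuousLinearMap.pi fun _ => ContinuousLinearMap.fst ℝ ℝ (ι → ℝ)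
        - (∑ i, c i • ContinuousLinearMap.proj i) ∘L ContinuousLinearMap.snd ℝ ℝ (ι → ℝ))
      (ContinuousLinearMap.snd ℝ ℝ (ι → ℝ))
  have hjoint : HasGaussianLaw (fun ω => ((fun _ : Unit => R ω), fun i => y i ω)) P := by
    have hT : (fun ω => ((fun _ : Unit => R ω), fun i => y i ω))
        = fun ω => T (U ω, fun i => y i ω) := by
      ext ω : 1
      refine Prod.ext (funext fun _ => ?_) rfl
      simp [T, hR]
    rw [hT]
    exact h.map_fun T
  have hcov (Z : Ω → ℝ) (hZ : MemLp Z 2 P) :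
      cov[R, Z; P] = cov[U, Z; P] - ∑ i, c i * cov[y i, Z; P] := by
    rw [hR, covariance_fun_sub_left hU2 hS2 hZ, covariance_fun_sum_left hcy2 hZ]
    simp_rw [covariance_const_mul_left]
  have hRy (j : ι) : cov[R, y j; P] = 0 := by rw [hcov _ (hy2 j), hc, sub_self]
  have hRlaw : HasGaussianLaw R P := hjoint.fst.eval ()
  have hR2 := hRlaw.memLp_two
  have hvar : Var[R; P] = cov[U, U; P] - ∑ i, c i * cov[U, y i; P] := by
    rw [← covariance_self hRlaw.aemeasurable]
    -- Since R is orthogonal to every regressor, Var R = Cov(R, U).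
    conv_lhs => rw [hR, covariance_fun_sub_right hR2 hU2 hS2, covariance_fun_sum_right hcy2 hR2]
    simp_rw [covariance_const_mul_right, hRy, mul_zero, Finset.sum_const_zero, sub_zero]
    rw [hcov U hU2]
    simp_rw [covariance_comm U]
  have hmean : P[R] = 0 := by
    rw [hR, integral_sub (hU2.integrable one_le_two) (hS2.integrable one_le_two),
      integral_finsetSum _ fun i _ => (hcy2 i).integrable one_le_two, hU0]
    simp [integral_const_mul, hy0]
  refine ⟨?_, hvar ▸ variance_nonneg _ _, hRlaw.aemeasurable, ?_⟩
  · have hind : IndepFun (fun ω (_ : Unit) => R ω) (fun ω i => y i ω) P :=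
      hjoint.indepFun_of_covariance_eval (X := fun _ : Unit => R) fun _ j => hRy j
    exact (hind.comp (measurable_pi_apply ()) measurable_id).symm
  · rw [hRlaw.map_eq_gaussianReal, hmean, hvar]

/-- Finitely many values of a Gaussian process, together with one more, are jointly Gaussian. -/
theorem hasGaussianLaw_eval_prodMk {Ω T ι : Type*} [MeasurableSpace Ω] [Fintype ι] {P : Measure Ω}
    {X : T → Ω → ℝ} (hX : IsGaussianProcess X P) (a : T) (b : ι → T) :
    HasGaussianLaw (fun ω => (X a ω, fun i => X (b i) ω)) P := by
  have h := (hX.comp_right (fun o : Option ι => o.elim a b)).hasGaussianLaw Finset.univ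
  let T : (↥(Finset.univ : Finset (Option ι)) → ℝ) →L[ℝ] ℝ × (ι → ℝ) :=
    ContinuousLinearMap.prod (ContinuousLinearMap.proj ⟨none, Finset.mem_univ _⟩)
      (ContinuousLinearMap.pi fun i => ContinuousLinearMap.proj ⟨some i, Finset.mem_univ _⟩)
  exact h.map_fun T

/-! ### Joint law of correction and targets; the prediction error -/

section Model

variable {Ω : Type*} {d n : ℕ} {Xo : Set (Cov d)} {x : Fin n → Cov d} {t : Fin n → Fin 2}
  {π : Cov d → ℝ} {m : Fin 2 → Cov d → Ω → ℝ} {ωhat : Cov d → ℝ} {Y : Fin n → Ω → ℝ}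
  {k l : Cov d → Cov d → ℝ} {s : Fin 2 → ℝ≥0}

theorem target_apply (ω : Ω) (i : Fin n) :
    target ωhat π x t Y ω i = correction m ωhat (x i) ω
      + ipwWeight π (t i) (x i) * nuisance m π (x i) ω + pseudoError m π x t Y i ω := by
  simp only [target, correction, pseudoError]
  ring

/-- This identifies the multitask kernel with the covariance of the pseudo-outcomes. `castSucc`
sends the two arms to the first two tasks; the third task, the effect itself, is never observed. -/
theorem loadB_castSucc (z : Cov d) (hz : 0 < π z ∧ π z < 1) (a : Fin 2) :
    loadB π z a.castSucc = ipwWeight π a z := by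
  have h1 : π z ≠ 0 := hz.1.ne'
  have h2 : 1 - π z ≠ 0 := (sub_pos.2 hz.2).ne'
  fin_cases a
  · simp only [loadB, ipwWeight]
    simp
    field_simp
  · simp only [loadB, ipwWeight]
    simp
    field_simp

theorem gram_apply (hπ : ∀ i, 0 < π (x i) ∧ π (x i) < 1) (i j : Fin n) :
    gram k l π x t i j = k (x i) (x j)
      + ipwWeight π (t i) (x i) * ipwWeight π (t j) (x j) * l (x i) (x j) := by
  have h (a : Fin 3) : loadA a = 1 := by fin_cases a <;> rfl
  simp only [gram, multitaskKernel, Matrix.of_apply, Matrix.add_apply, Matrix.smul_apply,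
    Matrix.vecMulVec_apply, smul_eq_mul, h, loadB_castSucc _ (hπ i), loadB_castSucc _ (hπ j)]
  ring

variable [MeasurableSpace Ω] {P : Measure Ω}

theorem IsCenteredGP.kernel_symm {f : Cov d → Ω → ℝ} (hf : IsCenteredGP Xo k f P) {a b : Cov d}
    (ha : a ∈ Xo) (hb : b ∈ Xo) : k a b = k b a := by
  rw [← hf.covariance_eq a ha b hb, ← hf.covariance_eq b hb a ha, covariance_comm]

theorem IsCenteredGP.hasGaussianLaw {f : Cov d → Ω → ℝ} (hf : IsCenteredGP Xo k f P) {a : Cov d}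
    (ha : a ∈ Xo) : HasGaussianLaw (f a) P :=
  hf.gaussian.hasGaussianLaw_eval ⟨a, ha⟩

theorem IsCenteredGP.memLp {f : Cov d → Ω → ℝ} (hf : IsCenteredGP Xo k f P) {a : Cov d}
    (ha : a ∈ Xo) : MemLp (f a) 2 P :=
  (hf.hasGaussianLaw ha).memLp_two

variable [IsProbabilityMeasure P]

/-- A covariance kernel is positive semidefinite. -/
theorem IsCenteredGP.sum_nonneg {f : Cov d → Ω → ℝ} (hf : IsCenteredGP Xo k f P)
    (hx : ∀ i, x i ∈ Xo) (c : Fin n → ℝ) : 0 ≤ ∑ i, ∑ j, c i * c j * k (x i) (x j) := by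
  have h2 (i : Fin n) : MemLp (fun ω => c i * f (x i) ω) 2 P := (hf.memLp (hx i)).const_mul _
  have h := variance_nonneg (fun ω => ∑ i, c i * f (x i) ω) P
  rw [← covariance_self (memLp_finsetSum _ fun i _ => h2 i).aemeasurable,
    covariance_fun_sum_fun_sum h2 h2] at h
  refine h.trans_eq (Finset.sum_congr rfl fun i _ => Finset.sum_congr rfl fun j _ => ?_)
  rw [covariance_const_mul_left, covariance_const_mul_right, hf.covariance_eq _ (hx i) _ (hx j)]
  ring

theorem posDef_gram_add_noiseCov (hx : ∀ i, x i ∈ Xo) (hπ : ∀ i, 0 < π (x i) ∧ π (x i) < 1)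
    {f g : Cov d → Ω → ℝ} (hf : IsCenteredGP Xo k f P) (hg : IsCenteredGP Xo l g P)
    (hs : ∀ a, 0 < s a) : (gram k l π x t + noiseCov s t).PosDef := by
  refine Matrix.PosDef.posSemidef_add ?_ ?_
  · refine Matrix.PosSemidef.of_dotProduct_mulVec_nonneg ?_ fun v => ?_
    · ext i j
      simp only [Matrix.conjTranspose_apply, star_trivial, gram_apply hπ,
        hf.kernel_symm (hx j) (hx i), hg.kernel_symm (hx j) (hx i)]
      ring
    · have h1 := hf.sum_nonneg hx v
      have h2 := hg.sum_nonneg hx fun i => v i * ipwWeight π (t i) (x i)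
      have h3 : star v ⬝ᵥ gram k l π x t *ᵥ v = (∑ i, ∑ j, v i * v j * k (x i) (x j))
          + ∑ i, ∑ j, v i * ipwWeight π (t i) (x i) * (v j * ipwWeight π (t j) (x j))
            * l (x i) (x j) := by
        simp only [star_trivial, dotProduct, Matrix.mulVec, Finset.mul_sum, gram_apply hπ,
          ← Finset.sum_add_distrib]
        refine Finset.sum_congr rfl fun i _ => Finset.sum_congr rfl fun j _ => ?_
        ring
      rw [h3]
      exact add_nonneg h1 h2
  · exact Matrix.PosDef.diagonal fun i => pow_pos (NNReal.coe_pos.2 (hs (t i))) 2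

/-- Joint law of one value of the correction function and the targets: it is Gaussian and centered,
with the covariances of the multitask kernel. -/
theorem joint_law (hx : ∀ i, x i ∈ Xo) (hπ : ∀ i, 0 < π (x i) ∧ π (x i) < 1)
    (hΔ : IsCenteredGP Xo k (correction m ωhat) P) (hφ : IsCenteredGP Xo l (nuisance m π) P)
    (hΔφ : IndepFun (fun ω (z : Xo) => correction m ωhat z ω)
      (fun ω (z : Xo) => nuisance m π z ω) P)
    (hε : ∀ i, HasLaw (pseudoError m π x t Y i) (gaussianReal 0 (s (t i) ^ 2)) P)
    (hεindep : iIndepFun (pseudoError m π x t Y) P)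
    (hεfun : IndepFun (fun ω i => pseudoError m π x t Y i ω)
      (fun ω => ((fun z : Xo => correction m ωhat z ω), (fun z : Xo => nuisance m π z ω))) P)
    {z : Cov d} (hz : z ∈ Xo) :
    HasGaussianLaw (fun ω => (correction m ωhat z ω, target ωhat π x t Y ω)) P ∧
      (∀ i, ∫ ω, target ωhat π x t Y ω i ∂P = 0) ∧
      (∀ i, cov[correction m ωhat z, fun ω => target ωhat π x t Y ω i; P] = k (x i) z) ∧
      ∀ i j, cov[fun ω => target ωhat π x t Y ω i, fun ω => target ωhat π x t Y ω j; P]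
        = (gram k l π x t + noiseCov s t) i j := by
  have hεlaw (i : Fin n) : HasGaussianLaw (pseudoError m π x t Y i) P := (hε i).hasGaussianLaw
  have hy (i : Fin n) : (fun ω => target ωhat π x t Y ω i) = correction m ωhat (x i)
      + (fun ω => ipwWeight π (t i) (x i) * nuisance m π (x i) ω) + pseudoError m π x t Y i :=
    funext fun ω => target_apply ω i
  have hA : HasGaussianLaw
      (fun ω => (correction m ωhat z ω, fun i => correction m ωhat (x i) ω)) P :=
    hasGaussianLaw_eval_prodMk hΔ.gaussian ⟨z, hz⟩ fun i => ⟨x i, hx i⟩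
  have hF : HasGaussianLaw (fun ω i => nuisance m π (x i) ω) P :=
    (hasGaussianLaw_eval_prodMk hφ.gaussian ⟨z, hz⟩ fun i => (⟨x i, hx i⟩ : Xo)).snd
  have hE : HasGaussianLaw (fun ω i => pseudoError m π x t Y i ω) P := hεindep.hasGaussianLaw hεlaw
  -- Independent Gaussian blocks are jointly Gaussian: φ is adjoined first, then the errors, which
  -- are independent of the pair.
  have hAF := IndepFun.hasGaussianLaw hA hF
    (hΔφ.comp (φ := fun f => (f ⟨z, hz⟩, fun i => f ⟨x i, hx i⟩)) (ψ := fun f i => f ⟨x i, hx i⟩)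
      (by fun_prop) (by fun_prop))
  have hAFE := IndepFun.hasGaussianLaw hAF hE
    (hεfun.symm.comp (φ := fun p : (Xo → ℝ) × (Xo → ℝ) =>
      ((p.1 ⟨z, hz⟩, fun i => p.1 ⟨x i, hx i⟩), fun i => p.2 ⟨x i, hx i⟩))
      (ψ := id) (by fun_prop) measurable_id)
  have hΔφ' {a b : Cov d} (ha : a ∈ Xo) (hb : b ∈ Xo) :
      cov[correction m ωhat a, nuisance m π b; P] = 0 :=
    (hΔφ.comp (measurable_pi_apply (⟨a, ha⟩ : Xo)) (measurable_pi_apply (⟨b, hb⟩ : Xo))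
      ).covariance_eq_zero (hΔ.memLp ha) (hφ.memLp hb)
  have hΔε {a : Cov d} (ha : a ∈ Xo) (i : Fin n) :
      cov[correction m ωhat a, pseudoError m π x t Y i; P] = 0 :=
    (hεfun.symm.comp ((measurable_pi_apply (⟨a, ha⟩ : Xo)).comp measurable_fst)
      (measurable_pi_apply i)).covariance_eq_zero (hΔ.memLp ha) (hεlaw i).memLp_two
  have hφε {a : Cov d} (ha : a ∈ Xo) (i : Fin n) :
      cov[nuisance m π a, pseudoError m π x t Y i; P] = 0 :=
    (hεfun.symm.comp ((measurable_pi_apply (⟨a, ha⟩ : Xo)).comp measurable_snd)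
      (measurable_pi_apply i)).covariance_eq_zero (hφ.memLp ha) (hεlaw i).memLp_two
  have hεε (i j : Fin n) : cov[pseudoError m π x t Y i, pseudoError m π x t Y j; P]
      = noiseCov s t i j := by
    rcases eq_or_ne i j with rfl | hij
    · rw [covariance_self (hεlaw i).aemeasurable, (hε i).variance_eq, variance_id_gaussianReal]
      simp [noiseCov]
    · rw [(hεindep.indepFun hij).covariance_eq_zero (hεlaw i).memLp_two (hεlaw j).memLp_two]
      simp [noiseCov, hij]
  have hwφ (i : Fin n) :
      MemLp (fun ω => ipwWeight π (t i) (x i) * nuisance m π (x i) ω) 2 P :=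
    (hφ.memLp (hx i)).const_mul _
  have hΔw (i : Fin n) := (hΔ.memLp (hx i)).add (hwφ i)
  have hε2 (i : Fin n) := (hεlaw i).memLp_two
  have hright (Z : Ω → ℝ) (hZ : MemLp Z 2 P) (i : Fin n) :
      cov[Z, fun ω => target ωhat π x t Y ω i; P] = cov[Z, correction m ωhat (x i); P]
        + ipwWeight π (t i) (x i) * cov[Z, nuisance m π (x i); P]
        + cov[Z, pseudoError m π x t Y i; P] := by
    rw [hy, covariance_add_right hZ (hΔw i) (hε2 i),
      covariance_add_right hZ (hΔ.memLp (hx i)) (hwφ i), covariance_const_mul_right]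
  refine ⟨?_, fun i => ?_, fun i => ?_, fun i j => ?_⟩
  · let T : ((ℝ × (Fin n → ℝ)) × (Fin n → ℝ)) × (Fin n → ℝ) →L[ℝ] ℝ × (Fin n → ℝ) :=
      LinearMap.toContinuousLinearMap
        { toFun := fun p => (p.1.1.1, fun i =>
            p.1.1.2 i + ipwWeight π (t i) (x i) * p.1.2 i + p.2 i)
          map_add' := fun p q => by
            refine Prod.ext rfl (funext fun i => ?_)
            simp only [Prod.fst_add, Prod.snd_add, Pi.add_apply]
            ring
          map_smul' := fun c p => by
            refine Prod.ext rfl (funext fun i => ?_)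
            simp only [Prod.smul_fst, Prod.smul_snd, Pi.smul_apply, smul_eq_mul, RingHom.id_apply]
            ring }
    have hT : (fun ω => (correction m ωhat z ω, target ωhat π x t Y ω)) = fun ω =>
        T (((correction m ωhat z ω, fun i => correction m ωhat (x i) ω),
          fun i => nuisance m π (x i) ω), fun i => pseudoError m π x t Y i ω) :=
      funext fun ω => Prod.ext rfl (funext fun i => target_apply ω i)
    rw [hT]
    exact hAFE.map_fun T
  · have hε0 : ∫ ω, pseudoError m π x t Y i ω ∂P = 0 := by
      rw [(hε i).integral_eq, integral_id_gaussianReal]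
    rw [hy, integral_add' ((hΔw i).integrable one_le_two) ((hε2 i).integrable one_le_two),
      hε0, add_zero,
      integral_add' ((hΔ.memLp (hx i)).integrable one_le_two) ((hwφ i).integrable one_le_two),
      integral_const_mul, hΔ.mean_zero _ (hx i), hφ.mean_zero _ (hx i), mul_zero, add_zero]
  · rw [hright _ (hΔ.memLp hz), hΔφ' hz (hx i), hΔε hz, hΔ.covariance_eq _ hz _ (hx i),
      hΔ.kernel_symm hz (hx i)]
    ring
  · have hyi : MemLp (fun ω => target ωhat π x t Y ω i) 2 P := by
      rw [hy]
      exact (hΔw i).add (hε2 i)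
    rw [hright _ hyi, covariance_comm _ (correction m ωhat (x j)), hright _ (hΔ.memLp (hx j)),
      covariance_comm _ (nuisance m π (x j)), hright _ (hφ.memLp (hx j)),
      covariance_comm _ (pseudoError m π x t Y j), hright _ (hε2 j),
      covariance_comm (nuisance m π (x j)) (correction m ωhat (x i)),
      covariance_comm (pseudoError m π x t Y j) (correction m ωhat (x i)),
      covariance_comm (pseudoError m π x t Y j) (nuisance m π (x i)),
      hΔφ' (hx j) (hx i), hΔφ' (hx i) (hx j), hΔε (hx j), hΔε (hx i), hφε (hx j), hφε (hx i), hεε,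
      hΔ.covariance_eq _ (hx j) _ (hx i), hφ.covariance_eq _ (hx j) _ (hx i),
      Matrix.add_apply, gram_apply hπ, hΔ.kernel_symm (hx j) (hx i),
      hφ.kernel_symm (hx j) (hx i)]
    have hsymm : noiseCov s t j i = noiseCov s t i j := 
      congrFun₂ (Matrix.diagonal_transpose fun i => (s (t i) : ℝ) ^ 2) i j
    rw [hsymm]
    ring

/-- The prediction error `Δ̂(z) - Δ̃(z)` is centered Gaussian with the posterior variance, and
independent of the targets. -/
theorem prediction_error (hx : ∀ i, x i ∈ Xo) (hπ : ∀ i, 0 < π (x i) ∧ π (x i) < 1)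
    (hΔ : IsCenteredGP Xo k (correction m ωhat) P) (hφ : IsCenteredGP Xo l (nuisance m π) P)
    (hΔφ : IndepFun (fun ω (z : Xo) => correction m ωhat z ω)
      (fun ω (z : Xo) => nuisance m π z ω) P)
    (hs : ∀ a, 0 < s a)
    (hε : ∀ i, HasLaw (pseudoError m π x t Y i) (gaussianReal 0 (s (t i) ^ 2)) P)
    (hεindep : iIndepFun (pseudoError m π x t Y) P)
    (hεfun : IndepFun (fun ω i => pseudoError m π x t Y i ω)
      (fun ω => ((fun z : Xo => correction m ωhat z ω), (fun z : Xo => nuisance m π z ω))) P)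
    {z : Cov d} (hz : z ∈ Xo) :
    AEMeasurable (target ωhat π x t Y) P ∧ 0 ≤ postCov k l π s x t z z ∧
      IndepFun (target ωhat π x t Y)
        (fun ω => correction m ωhat z ω - postMean k l π s x t z (target ωhat π x t Y ω)) P ∧
      HasLaw (fun ω => correction m ωhat z ω - postMean k l π s x t z (target ωhat π x t Y ω))
        (gaussianReal 0 (postCov k l π s x t z z).toNNReal) P := by
  obtain ⟨hlaw, hmean, hcross, hcov⟩ := joint_law hx hπ hΔ hφ hΔφ hε hεindep hεfun hz
  have hpd := posDef_gram_add_noiseCov (t := t) hx hπ hΔ hφ hs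
  -- Positive noise makes the matrix invertible, so `precision` is a genuine inverse.
  have hdet : IsUnit (gram k l π x t + noiseCov s t).det := hpd.det_pos.ne'.isUnit
  have hsymm : (precision k l π s x t)ᵀ = precision k l π s x t := by
    have := hpd.inv.isHermitian
    rwa [Matrix.IsHermitian, Matrix.conjTranspose_eq_transpose_of_trivial] at this
  -- The regression weights: they solve the normal equations, and symmetry of the inverse lets them
  -- be read off `postMean`.
  set c : Fin n → ℝ := precision k l π s x t *ᵥ crossCov k x z with hc
  have hcvec : c = crossCov k x z ᵥ* precision k l π s x t := by
    rw [hc, ← Matrix.vecMul_transpose, hsymm]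
  have hpost (y : Fin n → ℝ) : postMean k l π s x t z y = ∑ i, c i * y i := by
    rw [postMean, Matrix.dotProduct_mulVec, ← hcvec]
    rfl
  have hnormal (j : Fin n) : ∑ i, c i * cov[fun ω => target ωhat π x t Y ω i,
      fun ω => target ωhat π x t Y ω j; P]
        = cov[correction m ωhat z, fun ω => target ωhat π x t Y ω j; P] := by
    have h : c ᵥ* (gram k l π x t + noiseCov s t) = crossCov k x z := by
      rw [hcvec, Matrix.vecMul_vecMul, precision, Matrix.nonsing_inv_mul _ hdet, Matrix.vecMul_one]
    simp_rw [hcov, hcross]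
    exact congrFun h j
  obtain ⟨hind, hnn, hR⟩ := regression_residual (y := fun i ω => target ωhat π x t Y ω i) hlaw
    (hΔ.mean_zero z hz) hmean c hnormal
  have hvar : cov[correction m ωhat z, correction m ωhat z; P]
      - ∑ i, c i * cov[correction m ωhat z, fun ω => target ωhat π x t Y ω i; P]
      = postCov k l π s x t z z := by
    simp_rw [hcross, hΔ.covariance_eq z hz z hz, postCov]
    rw [dotProduct_comm]
    rfl
  rw [hvar] at hnn hR
  simp_rw [hpost]
  exact ⟨hlaw.snd.aemeasurable, hnn, hind, hR⟩

end Model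

/-! ### Moduli of continuity of the posterior mean and standard deviation -/

section Modulus

theorem abs_dotProduct_le {n : ℕ} (u v : Fin n → ℝ) :
    |u ⬝ᵥ v| ≤ ‖WithLp.toLp 2 u‖ * ‖WithLp.toLp 2 v‖ := by
  have h := abs_real_inner_le_norm (WithLp.toLp 2 u) (WithLp.toLp 2 v)
  rwa [EuclideanSpace.inner_toLp_toLp, star_trivial, dotProduct_comm] at h

theorem norm_toLp_mulVec_le {n : ℕ} (A : Matrix (Fin n) (Fin n) ℝ) (v : Fin n → ℝ) :
    ‖WithLp.toLp 2 (A *ᵥ v)‖ ≤ ‖Matrix.toEuclideanCLM (𝕜 := ℝ) A‖ * ‖WithLp.toLp 2 v‖ :=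
  (Matrix.toEuclideanCLM (𝕜 := ℝ) A).le_opNorm (WithLp.toLp 2 v)

theorem norm_toLp_le_sqrt_mul {n : ℕ} {u : Fin n → ℝ} {b : ℝ} (hb : 0 ≤ b)
    (hu : ∀ i, |u i| ≤ b) : ‖WithLp.toLp 2 u‖ ≤ √(n : ℝ) * b := by
  rw [EuclideanSpace.norm_eq, Real.sqrt_le_iff]
  refine ⟨by positivity, ?_⟩
  rw [mul_pow, Real.sq_sqrt (Nat.cast_nonneg n)]
  calc ∑ i, ‖u i‖ ^ 2 ≤ ∑ _i : Fin n, b ^ 2 := by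
        gcongr with i
        exact hu i
    _ = n * b ^ 2 := by simp

/-- The modulus of continuity of a quadratic form. -/
theorem abs_quadForm_sub_le {n : ℕ} (A : Matrix (Fin n) (Fin n) ℝ) {u v : Fin n → ℝ} {b e : ℝ}
    (hb : 0 ≤ b) (he : 0 ≤ e) (hu : ∀ i, |u i| ≤ b) (hv : ∀ i, |v i| ≤ b)
    (huv : ∀ i, |u i - v i| ≤ e) :
    |u ⬝ᵥ (A *ᵥ u) - v ⬝ᵥ (A *ᵥ v)| ≤ 2 * e * (n * ‖Matrix.toEuclideanCLM (𝕜 := ℝ) A‖ * b) := by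
  set a := ‖Matrix.toEuclideanCLM (𝕜 := ℝ) A‖
  have ha : 0 ≤ a := norm_nonneg _
  have hn : √(n : ℝ) * √(n : ℝ) = n := Real.mul_self_sqrt (Nat.cast_nonneg n)
  have hform (p q : Fin n → ℝ) {c c' : ℝ} (hc : 0 ≤ c) (hc' : 0 ≤ c') (hp : ∀ i, |p i| ≤ c)
      (hq : ∀ i, |q i| ≤ c') : |p ⬝ᵥ (A *ᵥ q)| ≤ c * c' * (n * a) := by
    calc |p ⬝ᵥ (A *ᵥ q)| ≤ ‖WithLp.toLp 2 p‖ * ‖WithLp.toLp 2 (A *ᵥ q)‖ := abs_dotProduct_le _ _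
      _ ≤ ‖WithLp.toLp 2 p‖ * (a * ‖WithLp.toLp 2 q‖) := by
        gcongr
        exact norm_toLp_mulVec_le A q
      _ ≤ (√(n : ℝ) * c) * (a * (√(n : ℝ) * c')) := by
        gcongr
        · exact norm_toLp_le_sqrt_mul hc hp
        · exact norm_toLp_le_sqrt_mul hc' hq
      _ = c * c' * (√(n : ℝ) * √(n : ℝ) * a) := by ring
      _ = c * c' * (n * a) := by rw [hn]
  have hsplit : u ⬝ᵥ (A *ᵥ u) - v ⬝ᵥ (A *ᵥ v)
      = (u - v) ⬝ᵥ (A *ᵥ u) + v ⬝ᵥ (A *ᵥ (u - v)) := by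
    rw [sub_dotProduct, Matrix.mulVec_sub, dotProduct_sub]
    ring
  rw [hsplit]
  refine (abs_add_le _ _).trans ?_
  linarith [hform (u - v) u he hb huv hu, hform v (u - v) hb he hv huv]

variable {Ω : Type*} [MeasurableSpace Ω] {P : Measure Ω}
  {d n : ℕ} {Xo : Set (Cov d)} {k l : Cov d → Cov d → ℝ} {f : Cov d → Ω → ℝ} {Lk : ℝ≥0}

/-- Two Lipschitz moves joined by symmetry lead from k(a, b) to k(o, o). Boundedness is needed
because `sSup` of an unbounded set of reals is 0. -/
theorem IsCenteredGP.bddAbove_kernel (hf : IsCenteredGP Xo k f P) (hXo : IsCompact Xo)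
    (hLk : ∀ z ∈ Xo, LipschitzOnWith Lk (k z) Xo) : BddAbove (Set.image2 k Xo Xo) := by
  rcases Xo.eq_empty_or_nonempty with rfl | ⟨o, ho⟩
  · simp
  refine ⟨k o o + Lk * Metric.diam Xo + Lk * Metric.diam Xo, ?_⟩
  rintro _ ⟨a, ha, b, hb, rfl⟩
  have hdiam {p : Cov d} (hp : p ∈ Xo) : (Lk : ℝ) * dist p o ≤ Lk * Metric.diam Xo := by
    gcongr
    exact Metric.dist_le_diam_of_mem hXo.isBounded hp ho
  have h1 := (le_abs_self _).trans ((hLk a ha).dist_le_mul b hb o ho)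
  have h2 := (le_abs_self _).trans ((hLk o ho).dist_le_mul a ha o ho)
  rw [hf.kernel_symm ha ho] at h1
  linarith [hdiam ha, hdiam hb]

variable [IsProbabilityMeasure P]

/-- Positive semidefiniteness tested on (1, 1) and (1, -1) gives 2|k(a, b)| ≤ k(a, a) + k(b, b), so
a supremum without absolute values suffices. -/
theorem IsCenteredGP.abs_kernel_le (hf : IsCenteredGP Xo k f P)
    (hbdd : BddAbove (Set.image2 k Xo Xo)) {a b : Cov d} (ha : a ∈ Xo) (hb : b ∈ Xo) :
    |k a b| ≤ sSup (Set.image2 k Xo Xo) := by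
  have hmem : ∀ i, ![a, b] i ∈ Xo := by
    intro i
    fin_cases i
    exacts [ha, hb]
  have h1 := hf.sum_nonneg hmem ![1, 1]
  have h2 := hf.sum_nonneg hmem ![1, -1]
  simp only [Fin.sum_univ_two, Matrix.cons_val_zero, Matrix.cons_val_one] at h1 h2
  rw [hf.kernel_symm hb ha] at h1 h2
  have h3 := le_csSup hbdd (Set.mem_image2_of_mem ha ha)
  have h4 := le_csSup hbdd (Set.mem_image2_of_mem hb hb)
  rw [abs_le]
  constructor <;> linarith

variable {x : Fin n → Cov d} {t : Fin n → Fin 2} {π : Cov d → ℝ} {s : Fin 2 → ℝ≥0} {r : ℝ≥0}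

theorem abs_crossCov_sub_le (hx : ∀ i, x i ∈ Xo) (hLk : ∀ z ∈ Xo, LipschitzOnWith Lk (k z) Xo)
    {z z' : Cov d} (hz : z ∈ Xo) (hz' : z' ∈ Xo) (hzz' : dist z z' ≤ r) (i : Fin n) :
    |crossCov k x z i - crossCov k x z' i| ≤ Lk * r :=
  ((hLk _ (hx i)).dist_le_mul z hz z' hz').trans (by gcongr)

theorem abs_postMean_sub_le (hx : ∀ i, x i ∈ Xo)
    (hLk : ∀ z ∈ Xo, LipschitzOnWith Lk (k z) Xo)
    {z z' : Cov d} (hz : z ∈ Xo) (hz' : z' ∈ Xo) (hzz' : dist z z' ≤ r) (y : Fin n → ℝ) :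
    |postMean k l π s x t z y - postMean k l π s x t z' y| ≤ lipMean k l π s x t Lk y * r := by
  rw [postMean, postMean, ← sub_dotProduct]
  refine (abs_dotProduct_le _ _).trans ?_
  have h : ‖WithLp.toLp 2 (crossCov k x z - crossCov k x z')‖ ≤ √(n : ℝ) * (Lk * r) :=
    norm_toLp_le_sqrt_mul (by positivity) (abs_crossCov_sub_le hx hLk hz hz' hzz')
  calc _ ≤ √(n : ℝ) * (Lk * r) * ‖WithLp.toLp 2 (precision k l π s x t *ᵥ y)‖ := by gcongr
    _ = lipMean k l π s x t Lk y * r := by rw [lipMean]; ring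

/-- The variance grows by at most e: k(z, z) moves by 2 r L_k, one L_k r per argument, and the
quadratic form by 2 r L_k n ‖(M_N + Σ_N)⁻¹‖ max k. Then √(a + e) ≤ √a + √e. -/
theorem postStd_le_add_modStd (hf : IsCenteredGP Xo k f P) (hXo : IsCompact Xo)
    (hx : ∀ i, x i ∈ Xo) (hLk : ∀ z ∈ Xo, LipschitzOnWith Lk (k z) Xo)
    {z z' : Cov d} (hz : z ∈ Xo) (hz' : z' ∈ Xo) (hzz' : dist z z' ≤ r)
    (hnn : 0 ≤ postCov k l π s x t z z) :
    postStd k l π s x t z' ≤ postStd k l π s x t z + modStd k l π s x t Xo Lk r := by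
  have hk {a b : Cov d} (ha : a ∈ Xo) (hb : b ∈ Xo) :=
    hf.abs_kernel_le (hf.bddAbove_kernel hXo hLk) ha hb
  set K := sSup (Set.image2 k Xo Xo) with hK
  have hK0 : 0 ≤ K := (abs_nonneg _).trans (hk hz hz)
  have hr : (Lk : ℝ) * dist z z' ≤ Lk * r := by gcongr
  have h1 := (abs_le.1 ((hLk z' hz').dist_le_mul z hz z' hz')).1
  have h2 := (abs_le.1 ((hLk z hz).dist_le_mul z hz z' hz')).1
  rw [hf.kernel_symm hz' hz] at h1
  have h3 := (abs_le.1 (abs_quadForm_sub_le (precision k l π s x t)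
    (u := crossCov k x z) (v := crossCov k x z') hK0
    (by positivity : (0 : ℝ) ≤ Lk * r) (fun i => hk (hx i) hz) (fun i => hk (hx i) hz')
    (abs_crossCov_sub_le hx hLk hz hz' hzz'))).2
  rw [postStd, postStd, modStd, ← hK]
  set a := postCov k l π s x t z z with ha
  set e := 2 * r * Lk * (1 + n * ‖Matrix.toEuclideanCLM (𝕜 := ℝ) (precision k l π s x t)‖ * K)
    with he
  have he0 : 0 ≤ e := by positivity
  have hstep : postCov k l π s x t z' z' ≤ a + e := by
    simp only [ha, he, postCov]
    linarith
  refine Real.sqrt_le_iff.2 ⟨by positivity, hstep.trans ?_⟩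
  rw [add_sq, Real.sq_sqrt hnn, Real.sq_sqrt he0]
  have : 0 ≤ 2 * √a * √e := by positivity
  linarith

end Modulus

/-! ### Covering argument and union bound -/

/-- A compact set has a finite cover whose cardinality is the covering number. -/
theorem exists_finset_isCover {d : ℕ} {Xo : Set (Cov d)} (hXo : IsCompact Xo) {r : ℝ≥0}
    (hr : 0 < r) : ∃ C : Finset (Cov d), (C : Set (Cov d)) ⊆ Xo ∧
      (∀ z ∈ Xo, ∃ c ∈ C, dist z c ≤ r) ∧ C.card = (Metric.coveringNumber r Xo).toNat := by
  obtain ⟨N, hN, hNfin, hNcov⟩ := Metric.exists_finite_isCover_of_isCompact hr.ne' hXo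
  have hne : Metric.coveringNumber r Xo ≠ ⊤ :=
    ne_top_of_le_ne_top hNfin.encard_lt_top.ne (hNcov.coveringNumber_le_encard hN)
  obtain ⟨C, hC, hCfin, hCcov, hCcard⟩ := Metric.exists_set_encard_eq_coveringNumber hne
  refine ⟨hCfin.toFinset, by simpa using hC, fun z hz => ?_, ?_⟩
  · have h := Metric.isCover_iff_subset_iUnion_closedBall.1 hCcov hz
    simpa using h
  · rw [← hCcard, hCfin.encard_eq_coe_toFinset_card, ENat.toNat_natCast]

/-- If the prediction errors have the posterior laws, then the band covers the treatment effect
uniformly with probability larger than `1 - δ`. -/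
theorem uniform_band {Ω : Type*} [MeasurableSpace Ω] {P : Measure Ω} [IsProbabilityMeasure P]
    {d n : ℕ} {Xo : Set (Cov d)} (hXo : IsCompact Xo)
    {x : Fin n → Cov d} {t : Fin n → Fin 2} (hx : ∀ i, x i ∈ Xo) {π : Cov d → ℝ}
    {m : Fin 2 → Cov d → Ω → ℝ} {ωhat : Cov d → ℝ} {k l : Cov d → Cov d → ℝ}
    (hΔ : IsCenteredGP Xo k (correction m ωhat) P) {s : Fin 2 → ℝ≥0} {y : Ω → Fin n → ℝ}
    (hnn : ∀ z ∈ Xo, 0 ≤ postCov k l π s x t z z)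
    (hlaw : ∀ z ∈ Xo, HasLaw (fun ω => correction m ωhat z ω - postMean k l π s x t z (y ω))
        (gaussianReal 0 (postCov k l π s x t z z).toNNReal) P)
    {Lk : ℝ≥0} (hLk : ∀ z ∈ Xo, LipschitzOnWith Lk (k z) Xo) {L : Ω → ℝ≥0}
    (hL : ∀ᵐ ω ∂P, LipschitzOnWith (L ω) (fun z => correction m ωhat z ω) Xo)
    {δ : ℝ} (hδ : δ ∈ Set.Ioo (0 : ℝ) 1) {r : ℝ≥0} (hr : 0 < r) :
    ∃ S : Set Ω, MeasurableSet S ∧ 1 - δ < P.real S ∧ ∀ ω ∈ S, ∀ z ∈ Xo,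
      |cateEstimate k l π s x t ωhat z (y ω) - cate m z ω|
        ≤ band k l π s x t Xo Lk (L ω) r δ (y ω) z := by
  obtain ⟨hδ0, hδ1⟩ := hδ
  -- An empty space has an empty net, for which β is not positive; the claim is then vacuous.
  rcases Xo.eq_empty_or_nonempty with rfl | ⟨o, ho⟩
  · exact ⟨Set.univ, .univ, by simpa using hδ0, by simp⟩
  obtain ⟨C, hCsub, hCcov, hCcard⟩ := exists_finset_isCover hXo hr
  have hCne : C.Nonempty := let ⟨c, hc, _⟩ := hCcov o ho; ⟨c, hc⟩
  have hcard : (1 : ℝ) ≤ C.card := by exact_mod_cast hCne.card_pos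
  have hβ : beta Xo r δ = 2 * Real.log (C.card / δ) := by rw [beta, hCcard]
  have hratio : 1 < C.card / δ := by
    rw [lt_div_iff₀ hδ0]
    linarith
  have hβpos : 0 < beta Xo r δ := by
    rw [hβ]
    exact mul_pos two_pos (Real.log_pos hratio)
  have hexp : Real.exp (-√(beta Xo r δ) ^ 2 / 2) = δ / C.card := by
    have hhalf : -(2 * Real.log (C.card / δ)) / 2 = -Real.log (C.card / δ) := by ring
    rw [Real.sq_sqrt hβpos.le, hβ, hhalf, Real.exp_neg, Real.exp_log (one_pos.trans hratio),
      inv_div]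
  let bad : Cov d → Set Ω := fun c => {ω | √(beta Xo r δ) * postStd k l π s x t c
    < |correction m ωhat c ω - postMean k l π s x t c (y ω)|}
  have hbad (c : Cov d) (hc : c ∈ C) : P.real (bad c) < δ / C.card := by
    have hc' := hCsub hc
    have htail := gaussianReal_real_lt_abs_lt (postCov k l π s x t c c).toNNReal
      (Real.sqrt_pos.2 hβpos)
    rw [hexp, ← (hlaw c hc').map_eq, Real.coe_toNNReal _ (hnn c hc'), measureReal_def,
      Measure.map_apply_of_aemeasurable (hlaw c hc').aemeasurable
        (measurableSet_lt measurable_const continuous_abs.measurable)] at htail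
    exact htail
  let null : Set Ω := {ω | ¬ LipschitzOnWith (L ω) (fun z => correction m ωhat z ω) Xo}
  have hnull : P.real null = 0 := by rw [measureReal_def, ae_iff.1 hL, ENNReal.toReal_zero]
  set exc : Set Ω := (⋃ c ∈ C, bad c) ∪ null
  have hexc : P.real exc < δ := by
    calc P.real exc ≤ P.real (⋃ c ∈ C, bad c) + P.real null := measureReal_union_le _ _
      _ = P.real (⋃ c ∈ C, bad c) := by rw [hnull, add_zero]
      _ ≤ ∑ c ∈ C, P.real (bad c) := measureReal_biUnion_finset_le _ _
      _ < ∑ _c ∈ C, δ / C.card := Finset.sum_lt_sum_of_nonempty hCne hbad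
      _ = δ := by
        rw [Finset.sum_const, nsmul_eq_mul]
        field_simp
  -- The exceptional set need not be measurable, as `L` is arbitrary and paths are only a.e.
  -- measurable; its measurable hull has the same measure.
  refine ⟨(toMeasurable P exc)ᶜ, (measurableSet_toMeasurable P exc).compl, ?_, fun ω hω z hz => ?_⟩
  · rw [probReal_compl_eq_one_sub (measurableSet_toMeasurable P exc), measureReal_def,
      measure_toMeasurable, ← measureReal_def]
    linarith
  have hω' : ω ∉ exc := fun h => hω (subset_toMeasurable P exc h)
  simp only [exc, Set.mem_union, Set.mem_iUnion, not_or, not_exists] at hω'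
  obtain ⟨hωbad, hωnull⟩ := hω'
  obtain ⟨c, hc, hzc⟩ := hCcov z hz
  have hc' := hCsub hc
  have hcenter : |correction m ωhat c ω - postMean k l π s x t c (y ω)|
      ≤ √(beta Xo r δ) * postStd k l π s x t c := not_lt.1 (hωbad c hc)
  have hpath : |correction m ωhat z ω - correction m ωhat c ω| ≤ L ω * r :=
    ((not_not.1 hωnull).dist_le_mul z hz c hc').trans (by gcongr)
  have hmean := abs_postMean_sub_le (l := l) (π := π) (s := s) (t := t) hx hLk hz hc' hzc (y ω)
  -- The bound at the centre involves σ(c), so σ(c) must be bounded by σ(z), not conversely.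
  have hstd := mul_le_mul_of_nonneg_left
    (postStd_le_add_modStd (l := l) (π := π) (s := s) (t := t) hΔ hXo hx hLk hz hc' hzc (hnn z hz))
    (Real.sqrt_nonneg (beta Xo r δ))
  have hsplit : cateEstimate k l π s x t ωhat z (y ω) - cate m z ω
      = (postMean k l π s x t z (y ω) - postMean k l π s x t c (y ω))
        - (correction m ωhat c ω - postMean k l π s x t c (y ω))
        - (correction m ωhat z ω - correction m ωhat c ω) := by
    simp only [cateEstimate, correction]
    ring
  rw [hsplit, band, gammaTerm]
  refine (abs_sub _ _).trans ?_
  refine (add_le_add_left (abs_sub _ _) _).trans ?_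
  linarith

end PseudoGP

theorem mainTheorem6 {Ω : Type*} [MeasurableSpace Ω] (P : Measure Ω) [IsProbabilityMeasure P]
    {d n : ℕ}
    -- the compact observational covariate space
    (Xo : Set (PseudoGP.Cov d)) (hXo : IsCompact Xo)
    -- the experimental design, with known propensity score satisfying overlap
    (x : Fin n → PseudoGP.Cov d) (t : Fin n → Fin 2) (hx : ∀ i, x i ∈ Xo)
    (π : PseudoGP.Cov d → ℝ) (hπ : ∀ i, 0 < π (x i) ∧ π (x i) < 1)
    -- mean potential outcomes, observational estimate, observed experimental outcomes
    (m : Fin 2 → PseudoGP.Cov d → Ω → ℝ) (ωhat : PseudoGP.Cov d → ℝ) (Y : Fin n → Ω → ℝ)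
    -- the correction function and the nuisance function are independent GP samples
    (k l : PseudoGP.Cov d → PseudoGP.Cov d → ℝ)
    (hΔ : PseudoGP.IsCenteredGP Xo k (PseudoGP.correction m ωhat) P)
    (hφ : PseudoGP.IsCenteredGP Xo l (PseudoGP.nuisance m π) P)
    (hΔφ : IndepFun (fun ω (z : Xo) => PseudoGP.correction m ωhat z ω)
      (fun ω (z : Xo) => PseudoGP.nuisance m π z ω) P)
    -- independent errors, `N(0, σ_t²)` given treatment `t`, independent of the functions
    (s : Fin 2 → ℝ≥0) (hs : ∀ a, 0 < s a)
    (hε : ∀ i, HasLaw (PseudoGP.pseudoError m π x t Y i) (gaussianReal 0 (s (t i) ^ 2)) P)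
    (hεindep : iIndepFun (PseudoGP.pseudoError m π x t Y) P)
    (hεfun : IndepFun (fun ω i => PseudoGP.pseudoError m π x t Y i ω)
      (fun ω => ((fun z : Xo => PseudoGP.correction m ωhat z ω),
        (fun z : Xo => PseudoGP.nuisance m π z ω))) P)
    -- Lipschitz constants of the kernel (in each argument) and of the sample path
    (Lk : ℝ≥0) (hLk : ∀ z ∈ Xo, LipschitzOnWith Lk (k z) Xo)
    (L : Ω → ℝ≥0)
    (hL : ∀ᵐ ω ∂P, LipschitzOnWith (L ω) (fun z => PseudoGP.correction m ωhat z ω) Xo) :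
    -- the pointwise posterior of the correction function is `N(Δ̃(z), σ²(z))`
    (∀ z ∈ Xo,
      condDistrib (PseudoGP.correction m ωhat z) (PseudoGP.target ωhat π x t Y) P
        =ᵐ[P.map (PseudoGP.target ωhat π x t Y)]
      fun y => gaussianReal (PseudoGP.postMean k l π s x t z y)
        (Real.toNNReal (PseudoGP.postStd k l π s x t z ^ 2))) ∧
    -- the uniform error bound, with probability larger than `1 - δ`
    (∀ δ ∈ Set.Ioo (0 : ℝ) 1, ∀ r : ℝ≥0, 0 < r →
      ∃ S : Set Ω, MeasurableSet S ∧ 1 - δ < P.real S ∧ ∀ ω ∈ S, ∀ z ∈ Xo,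
        |PseudoGP.cateEstimate k l π s x t ωhat z (PseudoGP.target ωhat π x t Y ω)
            - PseudoGP.cate m z ω|
          ≤ PseudoGP.band k l π s x t Xo Lk (L ω) r δ (PseudoGP.target ωhat π x t Y ω) z) := by
  have herr {z : PseudoGP.Cov d} (hz : z ∈ Xo) :=
    PseudoGP.prediction_error hx hπ hΔ hφ hΔφ hs hε hεindep hεfun hz
  refine ⟨fun z hz => ?_, fun δ hδ r hr => ?_⟩
  · obtain ⟨hmeas, hnn, hind, hlaw⟩ := herr hz
    have hpost : Measurable (PseudoGP.postMean k l π s x t z) := by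
      unfold PseudoGP.postMean dotProduct Matrix.mulVec dotProduct
      fun_prop
    rw [PseudoGP.postStd, Real.sq_sqrt hnn]
    exact PseudoGP.condDistrib_add_gaussian hmeas hpost hlaw hind fun ω => by ring
  · exact PseudoGP.uniform_band hXo hx hΔ (fun z hz => (herr hz).2.1)
      (fun z hz => (herr hz).2.2.2) hLk hL hδ hr
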